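/- **Model.** Let $\mathcal U$ be the uniform distribution on $\{0,1\}^n$ and $\|g\|_2=(\mathbf E_{x\sim\mathcal U}[g(x)^2])^{1/2}$. A learning algorithm on $\{0,1\}^n$ is a randomized, adaptive procedure of unlimited computational power. At each step, depending on its internal randomness and on the labeled points received so far, it either asks for a random example $(x,f(x))$ of the unknown target $f$, with a fresh independent $x\sim\mathcal U$; or makes a value query, receiving $f(x)$ for a point $x$ of its choice; or stops and returns a hypothesis $h:\{0,1\}^n\to\mathbb R$. It PAC learns a class $\mathcal F$ of functions $\{0,1\}^n\to\mathbb R$ to $\ell_2$ error $\varepsilon$ if for every $f\in\mathcal F$, with probability at least $2/3$ (over the examples and its internal randomness), it returns $h$ with $\|f-h\|_2\le\varepsilon$. A function $f:\{0,1\}^n\to\mathbb R$ is monotone if $f(x)\le f(y)$ whenever $x\le y$ coordinatewise, and submodular if $f(x\vee y)+f(x\wedge y)\le f(x)+f(y)$ for all $x,y$ (coordinatewise maximum and minimum). **Theorem.** Any algorithm that PAC learns all monotone submodular functions with range in $[0,1]$ to $\ell_2$ error $\varepsilon$ requires $2^{\Omega(\varepsilon^{-4/5})}$ random examples of, or value queries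 to, the target function. Precisely: there are absolute constants $c,C,\varepsilon_0>0$ such that for every $0<\varepsilon\le\varepsilon_0$, every integer $n\ge C\varepsilon^{-4/5}$, every learning algorithm on $\{0,1\}^n$ that PAC learns the class of all monotone submodular functions $f:\{0,1\}^n\to[0,1]$ to $\ell_2$ error $\varepsilon$, and every integer $q\ge 0$: if for every target $f$ in this class the algorithm almost surely stops after at most $q$ requests (random examples and value queries counted together), then $$q\ \ge\ 2^{c\,\varepsilon^{-4/5}}.$$ -/

import Mathlib

open MeasureTheory

noncomputable section

namespace SubmodularLearning

/-- The Boolean cube `{0,1}^n`, ordered coordinatewise; a point is the indicator of a subset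
of `[n]`, with `⊔` the union and `⊓` the intersection. -/
abbrev Cube (n : ℕ) : Type := Fin n → Bool

/-- Submodularity, `f (A ∪ B) + f (A ∩ B) ≤ f A + f B`. -/
def Submodular {n : ℕ} (f : Cube n → ℝ) : Prop :=
  ∀ x y : Cube n, f (x ⊔ y) + f (x ⊓ y) ≤ f x + f y

/-- The class of all monotone submodular functions on `{0,1}^n` with range in `[0,1]`. -/
def monotoneSubmodular (n : ℕ) : Set (Cube n → ℝ) :=
  {f | Monotone f ∧ Submodular f ∧ ∀ x, f x ∈ Set.Icc (0 : ℝ) 1}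

/-- The norm `‖f‖₂ = (E_{x ∼ U} [f(x)²])^{1/2}` for the uniform distribution `U` on the cube. -/
def l2norm {n : ℕ} (f : Cube n → ℝ) : ℝ :=
  Real.sqrt ((∑ x : Cube n, f x ^ 2) / 2 ^ n)

/-- The uniform distribution on the cube. -/
def uniform (n : ℕ) : Measure (Cube n) :=
  (PMF.uniformOfFintype (Cube n)).toMeasure

/-- What a learning algorithm can do next: ask for a random labeled example, ask for the value
of the target at a point of its choice, or stop and return a hypothesis. -/
inductive Action (n : ℕ) : Type
  | drawExample : Action n
  | valueQuery (x : Cube n) : Action n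
  | output (h : Cube n → ℝ) : Action n

/-- An action as an element of a disjoint union. -/
def Action.toSum {n : ℕ} : Action n → Unit ⊕ Cube n ⊕ (Cube n → ℝ)
  | .drawExample => Sum.inl ()
  | .valueQuery x => Sum.inr (Sum.inl x)
  | .output h => Sum.inr (Sum.inr h)

instance (n : ℕ) : MeasurableSpace (Action n) :=
  MeasurableSpace.comap Action.toSum inferInstance

/-- A randomized, adaptive learning algorithm for real-valued functions on `{0,1}^n`, with
unbounded computational power. Its internal randomness is a seed drawn from an arbitrary
probability space. The next action is an arbitrary (measurable in the seed) function of the seed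
and of the list of labeled points received so far, in the order in which they were received. -/
structure Learner (n : ℕ) where
  Seed : Type
  [instSeed : MeasurableSpace Seed]
  law : Measure Seed
  [isProb : IsProbabilityMeasure law]
  step : Seed → List (Cube n × ℝ) → Action n
  measurable_step : ∀ l : List (Cube n × ℝ), Measurable fun s => step s l

attribute [instance] Learner.instSeed Learner.isProb

namespace Learner

variable {n : ℕ} (A : Learner n)

/-- The labeled points received by `A` in its first `i` requests about the target `f` (fewer, if
`A` stops before), with seed `s` and random points `X 0, X 1, …`; the `i`-th request, if it is
for a random example, is answered with the fresh point `X i`, labeled by `f`. -/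
def history (f : Cube n → ℝ) (s : A.Seed) (X : ℕ → Cube n) : ℕ → List (Cube n × ℝ)
  | 0 => []
  | i + 1 =>
    match A.step s (history f s X i) with
    | .drawExample => history f s X i ++ [(X i, f (X i))]
    | .valueQuery x => history f s X i ++ [(x, f x)]
    | .output _ => history f s X i

/-- On this run, `A` stops after at most `q` requests (random examples and value queries
together). -/
def HaltsWithin (f : Cube n → ℝ) (s : A.Seed) (X : ℕ → Cube n) (q : ℕ) : Prop :=
  ∃ h, A.step s (A.history f s X q) = .output h

/-- On this run, `A` stops (after some number of requests) and returns the hypothesis `h`. -/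
def Returns (f : Cube n → ℝ) (s : A.Seed) (X : ℕ → Cube n) (h : Cube n → ℝ) : Prop :=
  ∃ i, A.step s (A.history f s X i) = .output h

/-- The joint law of the seed of `A` and of an independent sequence of independent uniformly
distributed points of the cube. -/
def runLaw : Measure (A.Seed × (ℕ → Cube n)) :=
  A.law.prod (Measure.infinitePi fun _ : ℕ => uniform n)

/-- `A` PAC learns the class `F` over the uniform distribution to `ℓ₂` error `ε`: for every
target in `F`, with probability at least `2/3`, `A` returns a hypothesis within `ℓ₂` distance
`ε` of the target. -/
def PACLearns (F : Set (Cube n → ℝ)) (ε : ℝ) : Prop :=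
  ∀ f ∈ F, 2 / 3 ≤ A.runLaw {r | ∃ h, A.Returns f r.1 r.2 h ∧ l2norm (f - h) ≤ ε}

/-- For every target in `F`, almost surely `A` makes at most `q` requests in total. -/
def UsesAtMost (F : Set (Cube n → ℝ)) (q : ℕ) : Prop :=
  ∀ f ∈ F, ∀ᵐ r ∂A.runLaw, A.HaltsWithin f r.1 r.2 q

end Learner

end SubmodularLearning

end

noncomputable section

namespace SubmodularLearning

open Finset symmDiff

/-! ### Perturbed capped cardinality functions -/

/-! Fix `2 * m` coordinates. Cardinality capped at `m` has enough slack around level `m` that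
lowering it by `1/2` on any family `b` of `m`-sets keeps it monotone and submodular. With `N =
m.centralBinom` this gives `2 ^ N` targets, each value being one of two known numbers. A label thus
carries at most one bit: for fixed randomness, `q` requests lead to at most `2 ^ q` histories, hence
to as many hypotheses (`card_image_history_le`). After division by `m`, the squared distance of two
targets is `|b ∆ b'| / (4 m² 4^m)`. Since `N` has order `4^m / √m`, families differing on a constant
fraction of the layer are at distance of order `m^(-5/4)`; so for `m` of order `ε^(-4/5)` an
`ε`-ball holds at most `2 ^ (N/2)` targets (`card_hammingBall_sq_le`). Averaging over the randomness
(`two_mul_card_le`) forces `q` to be about `N/2`, which exceeds `2 ^ m`. -/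

/-- The set of coordinates in `T` at which `x` is `1`. -/
def supp {n : ℕ} (T : Finset (Fin n)) (x : Cube n) : Finset (Fin n) := T.filter fun i => x i = true

open Classical in
/-- The cardinality capped at `m`, lowered by `1/2` on the sets of size `m` that belong to `b`. -/
def capped {α : Type*} (m : ℕ) (b : Finset (Finset α)) (A : Finset α) : ℝ :=
  min (A.card : ℝ) m - if A.card = m ∧ A ∈ b then 1 / 2 else 0

section capped

variable {α : Type*} {m : ℕ} (b : Finset (Finset α)) {A B : Finset α}

lemma capped_of_lt (h : A.card < m) : capped m b A = A.card := by
  have h' : (A.card : ℝ) ≤ m := by exact_mod_cast h.le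
  simp [capped, h.ne, h']

lemma capped_of_gt (h : m < A.card) : capped m b A = m := by
  have h' : (m : ℝ) ≤ A.card := by exact_mod_cast h.le
  simp [capped, h.ne', h']

lemma capped_le_card : capped m b A ≤ A.card := by
  unfold capped
  have := min_le_left (A.card : ℝ) m
  split_ifs <;> linarith

lemma capped_le : capped m b A ≤ m := by
  unfold capped
  have := min_le_right (A.card : ℝ) m
  split_ifs <;> linarith

lemma le_capped (h : m ≤ A.card) : (m : ℝ) - 1 / 2 ≤ capped m b A := by
  have h' : (m : ℝ) ≤ A.card := by exact_mod_cast h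
  unfold capped
  rw [min_eq_right h']
  split_ifs <;> linarith

lemma capped_nonneg (hm : 0 < m) : 0 ≤ capped m b A := by
  have hm' : (1 : ℝ) ≤ m := by exact_mod_cast hm
  rcases lt_or_ge A.card m with h | h
  · rw [capped_of_lt b h]; positivity
  · linarith [le_capped b h]

lemma capped_mono (h : A ⊆ B) : capped m b A ≤ capped m b B := by
  rcases h.eq_or_ssubset with rfl | h
  · rfl
  have hc := card_lt_card h
  have hc' : (A.card : ℝ) + 1 ≤ B.card := by exact_mod_cast hc
  have hA := capped_le_card (m := m) b (A := A)
  have hA' := capped_le (m := m) b (A := A)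
  rcases lt_trichotomy B.card m with h1 | h1 | h1
  · rw [capped_of_lt b h1]; linarith
  · have h2 : (B.card : ℝ) = m := by exact_mod_cast h1
    linarith [le_capped b h1.ge]
  · rw [capped_of_gt b h1]; exact hA'

/-- For incomparable sets the intersection is smaller than either by at least one. When it lies
below level `m`, this unit pays for the two possible dips of `1/2` on the right. -/
lemma capped_union_add_capped_inter_le [DecidableEq α] :
    capped m b (A ∪ B) + capped m b (A ∩ B) ≤ capped m b A + capped m b B := by
  by_cases hAB : A ⊆ B
  · rw [union_eq_right.2 hAB, inter_eq_left.2 hAB, add_comm]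
  by_cases hBA : B ⊆ A
  · rw [union_eq_left.2 hBA, inter_eq_right.2 hBA]
  have hA : (A ∩ B).card < A.card :=
    card_lt_card ⟨inter_subset_left, fun h => hAB fun x hx => (mem_inter.1 (h hx)).2⟩
  have hB : (A ∩ B).card < B.card :=
    card_lt_card ⟨inter_subset_right, fun h => hBA fun x hx => (mem_inter.1 (h hx)).1⟩
  have hs := card_union_add_card_inter A B
  have hA' : ((A ∩ B).card : ℝ) + 1 ≤ A.card := by exact_mod_cast hA
  have hB' : ((A ∩ B).card : ℝ) + 1 ≤ B.card := by exact_mod_cast hB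
  have hs' : ((A ∪ B).card : ℝ) + (A ∩ B).card = A.card + B.card := by exact_mod_cast hs
  have u1 := capped_le_card (m := m) b (A := A ∪ B)
  have u2 := capped_le (m := m) b (A := A ∪ B)
  have i1 := capped_le_card (m := m) b (A := A ∩ B)
  have i2 := capped_le (m := m) b (A := A ∩ B)
  by_cases hp : m ≤ (A ∩ B).card
  · rw [capped_of_gt b (hp.trans_lt hA), capped_of_gt b (hp.trans_lt hB)]
    linarith
  have hp' : ((A ∩ B).card : ℝ) + 1 ≤ m := by exact_mod_cast not_le.1 hp
  rcases lt_or_ge A.card m with h1 | h1 <;> rcases lt_or_ge B.card m with h2 | h2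
  · rw [capped_of_lt b h1, capped_of_lt b h2]; linarith
  · rw [capped_of_lt b h1]; linarith [le_capped b h2]
  · rw [capped_of_lt b h2]; linarith [le_capped b h1]
  · linarith [le_capped b h1, le_capped b h2]

end capped

/-- The capped cardinality of the part of the input in `T`, perturbed on the middle layer
according to `b` and normalized to range `[0,1]`. -/
def target {n : ℕ} (T : Finset (Fin n)) (m : ℕ) (b : Finset (Finset (Fin n))) (x : Cube n) : ℝ :=
  capped m b (supp T x) / m

section target

variable {n : ℕ}

lemma supp_sup (T : Finset (Fin n)) (x y : Cube n) : supp T (x ⊔ y) = supp T x ∪ supp T y := by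
  ext i; simp [supp]; tauto

lemma supp_inf (T : Finset (Fin n)) (x y : Cube n) : supp T (x ⊓ y) = supp T x ∩ supp T y := by
  ext i; simp [supp]; tauto

lemma target_mem_monotoneSubmodular (T : Finset (Fin n)) {m : ℕ} (hm : 0 < m)
    (b : Finset (Finset (Fin n))) : target T m b ∈ monotoneSubmodular n := by
  have hm' : (0 : ℝ) < m := by exact_mod_cast hm
  refine ⟨fun x y hxy => ?_, fun x y => ?_, fun x => ⟨?_, ?_⟩⟩
  · refine div_le_div_of_nonneg_right (capped_mono b ?_) hm'.le
    rw [← sup_eq_right.2 hxy, supp_sup]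
    exact subset_union_left
  · simp only [target, supp_sup, supp_inf, ← add_div]
    exact div_le_div_of_nonneg_right (capped_union_add_capped_inter_le b) hm'.le
  · exact div_nonneg (capped_nonneg b hm) hm'.le
  · exact (div_le_one hm').2 (capped_le b)

lemma target_eq_or (T : Finset (Fin n)) (m : ℕ) (b : Finset (Finset (Fin n))) (x : Cube n) :
    target T m b x = min ((supp T x).card : ℝ) m / m ∨
      target T m b x = (min ((supp T x).card : ℝ) m - 1 / 2) / m := by
  unfold target capped
  split_ifs <;> simp

/-! ### Distances between targets -/

lemma card_supp_fiber (T A : Finset (Fin n)) (hA : A ⊆ T) :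
    2 ^ (n - T.card) ≤ (univ.filter fun x : Cube n => supp T x = A).card := by
  have : (Tᶜ.powerset).card = 2 ^ (n - T.card) := by simp [card_compl]
  rw [← this]
  refine card_le_card_of_injOn (fun Y i => decide (i ∈ A ∪ Y)) (fun Y hY => ?_) ?_
  · replace hY : Y ⊆ Tᶜ := mem_powerset.1 hY
    simp only [coe_filter, mem_univ, true_and, Set.mem_ofPred_eq]
    ext i
    have h1 := @hA i
    have h2 := @hY i
    simp only [mem_compl] at h2
    simp only [supp, mem_filter, mem_union, decide_eq_true_eq]
    tauto
  · intro Y hY Z hZ h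
    replace hY : Y ⊆ Tᶜ := mem_powerset.1 hY
    replace hZ : Z ⊆ Tᶜ := mem_powerset.1 hZ
    ext i
    have h0 := congrFun h i
    have h1 := @hA i
    have h2 := @hY i
    have h3 := @hZ i
    simp only [mem_compl] at h2 h3
    simp only [mem_union, decide_eq_decide] at h0
    tauto

/-- The targets differ by exactly `1 / (2m)` wherever the trace on `T` lies in `b ∆ b'`, and the
coordinates outside `T` are free. -/
lemma card_symmDiff_mul_le_sum (T : Finset (Fin n)) {m : ℕ} (hm : 0 < m)
    {b b' : Finset (Finset (Fin n))} (hb : b ⊆ T.powersetCard m) (hb' : b' ⊆ T.powersetCard m) :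
    ((b ∆ b').card * 2 ^ (n - T.card) : ℝ) ≤
      4 * m ^ 2 * ∑ x : Cube n, (target T m b x - target T m b' x) ^ 2 := by
  have hm' : (0 : ℝ) < m := by exact_mod_cast hm
  have hmem : ∀ A ∈ b ∆ b', A ∈ T.powersetCard m := fun A hA => by
    rcases mem_symmDiff.1 hA with h | h
    exacts [hb h.1, hb' h.1]
  have key : ∀ x : Cube n, supp T x ∈ b ∆ b' →
      4 * (m : ℝ) ^ 2 * (target T m b x - target T m b' x) ^ 2 = 1 := by
    intro x hx
    have hc := (mem_powersetCard.1 (hmem _ hx)).2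
    rcases mem_symmDiff.1 hx with h | h <;>
    · simp only [target, capped, hc, h, true_and, if_true, if_false]
      field_simp
      ring
  have hcount : (b ∆ b').card * 2 ^ (n - T.card) ≤
      (univ.filter fun x : Cube n => supp T x ∈ b ∆ b').card := by
    rw [mul_comm]
    refine mul_card_image_le_card_of_maps_to (f := supp T) (fun x hx => (mem_filter.1 hx).2) _
      fun A hA => ?_
    refine (card_supp_fiber T A (mem_powersetCard.1 (hmem A hA)).1).trans (card_le_card ?_)
    intro x hx
    have hx := (mem_filter.1 hx).2
    simp [hx, hA]
  calc ((b ∆ b').card * 2 ^ (n - T.card) : ℝ)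
      ≤ ((univ.filter fun x : Cube n => supp T x ∈ b ∆ b').card : ℝ) := by exact_mod_cast hcount
    _ = ∑ x ∈ univ.filter fun x : Cube n => supp T x ∈ b ∆ b',
          4 * (m : ℝ) ^ 2 * (target T m b x - target T m b' x) ^ 2 := by
        rw [sum_congr rfl fun x hx => key x (mem_filter.1 hx).2]; simp
    _ ≤ ∑ x, 4 * (m : ℝ) ^ 2 * (target T m b x - target T m b' x) ^ 2 :=
        sum_le_sum_of_subset_of_nonneg (filter_subset _ _) fun _ _ _ => by positivity
    _ = _ := by rw [mul_sum]

lemma sum_sq_le_of_l2norm_le {f : Cube n → ℝ} {ε : ℝ} (hf : l2norm f ≤ ε) :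
    ∑ x, f x ^ 2 ≤ ε ^ 2 * 2 ^ n := by
  have := (Real.sqrt_le_left ((Real.sqrt_nonneg _).trans hf)).1 hf
  rwa [div_le_iff₀ (by positivity)] at this

lemma sum_sq_sub_le {f g h : Cube n → ℝ} {ε : ℝ} (hf : l2norm (f - h) ≤ ε)
    (hg : l2norm (g - h) ≤ ε) : ∑ x, (f x - g x) ^ 2 ≤ 4 * ε ^ 2 * 2 ^ n := by
  have h1 := sum_sq_le_of_l2norm_le hf
  have h2 := sum_sq_le_of_l2norm_le hg
  simp only [Pi.sub_apply] at h1 h2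
  calc ∑ x, (f x - g x) ^ 2 ≤ ∑ x, (2 * (f x - h x) ^ 2 + 2 * (g x - h x) ^ 2) :=
        sum_le_sum fun x _ => by nlinarith [sq_nonneg ((f x - h x) + (g x - h x))]
    _ = 2 * ∑ x, (f x - h x) ^ 2 + 2 * ∑ x, (g x - h x) ^ 2 := by
        rw [sum_add_distrib, mul_sum, mul_sum]
    _ ≤ _ := by linarith

end target

/-! ### Counting -/

/-- Chernoff-style count: translate the centre to `∅` and give `d` the weight `4 ^ (|P| - |d|)`. The
total weight is `5 ^ |P|`, while every set in the ball is heavy. -/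
lemma card_hammingBall_sq_le {α : Type*} [DecidableEq α] (P b₀ : Finset α) (hb₀ : b₀ ⊆ P)
    (S : Finset (Finset α)) (hS : ∀ b ∈ S, b ⊆ P ∧ 16 * (b ∆ b₀).card ≤ P.card) :
    S.card ^ 2 ≤ 2 ^ P.card := by
  have hinj : Set.InjOn (fun b => b ∆ b₀) (S : Set (Finset α)) :=
    fun x _ y _ h => symmDiff_left_injective b₀ h
  have h1 : ∀ d ∈ S.image (fun b => b ∆ b₀), d ⊆ P ∧ 16 * d.card ≤ P.card := by
    intro d hd
    obtain ⟨b, hb, rfl⟩ := mem_image.1 hd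
    refine ⟨fun a ha => ?_, (hS b hb).2⟩
    rcases mem_symmDiff.1 ha with h | h
    exacts [(hS b hb).1 h.1, hb₀ h.1]
  have h2 : S.card * 4 ^ (P.card - P.card / 16) ≤ 5 ^ P.card := by
    calc S.card * 4 ^ (P.card - P.card / 16)
        = ∑ d ∈ S.image (fun b => b ∆ b₀), 4 ^ (P.card - P.card / 16) := by
          rw [sum_const, card_image_of_injOn hinj, smul_eq_mul]
      _ ≤ ∑ d ∈ S.image (fun b => b ∆ b₀), 1 ^ d.card * 4 ^ (P.card - d.card) := by
          refine sum_le_sum fun d hd => ?_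
          rw [one_pow, one_mul]
          refine Nat.pow_le_pow_right (by norm_num) ?_
          have := (h1 d hd).2
          omega
      _ ≤ ∑ d ∈ P.powerset, 1 ^ d.card * 4 ^ (P.card - d.card) :=
          sum_le_sum_of_subset fun d hd => mem_powerset.2 (h1 d hd).1
      _ = 5 ^ P.card := by rw [sum_pow_mul_eq_add_pow]
  -- Sixteenth powers absorb the rounding in `P.card / 16`; numerically, `5 ^ 16 ≤ 256 * 4 ^ 15`.
  have h3 : S.card ^ 16 * (4 ^ 15) ^ P.card ≤ 256 ^ P.card * (4 ^ 15) ^ P.card := by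
    calc S.card ^ 16 * (4 ^ 15) ^ P.card
        ≤ S.card ^ 16 * (4 ^ (P.card - P.card / 16)) ^ 16 := by
          refine Nat.mul_le_mul_left _ ?_
          rw [← pow_mul, ← pow_mul]
          exact Nat.pow_le_pow_right (by norm_num) (by omega)
      _ = (S.card * 4 ^ (P.card - P.card / 16)) ^ 16 := by rw [mul_pow]
      _ ≤ (5 ^ P.card) ^ 16 := Nat.pow_le_pow_left h2 _
      _ = (5 ^ 16) ^ P.card := by rw [← pow_mul, ← pow_mul, mul_comm]
      _ ≤ (256 * 4 ^ 15) ^ P.card := Nat.pow_le_pow_left (by norm_num) _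
      _ = _ := by rw [mul_pow]
  have h4 := Nat.le_of_mul_le_mul_right h3 (by positivity)
  refine (Nat.pow_le_pow_iff_left (n := 8) (by norm_num)).1 ?_
  calc (S.card ^ 2) ^ 8 = S.card ^ 16 := by rw [← pow_mul]
    _ ≤ 256 ^ P.card := h4
    _ = (2 ^ P.card) ^ 8 := by rw [← pow_mul, mul_comm, pow_mul]; norm_num

/-- Squared form of `4^m ≤ 2 √m * centralBinom m`; the induction rests on `4m(m+1) ≤ (2m+1)²`. -/
lemma sixteen_pow_le_mul_centralBinom_sq {m : ℕ} (hm : 0 < m) :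
    16 ^ m ≤ 4 * m * m.centralBinom ^ 2 := by
  induction m, hm using Nat.le_induction with
  | base => simp [Nat.centralBinom, Nat.choose]
  | succ m hm ih =>
    have h := Nat.succ_mul_centralBinom_succ m
    refine Nat.le_of_mul_le_mul_left (c := m + 1) ?_ (by positivity)
    calc (m + 1) * 16 ^ (m + 1) = 16 * (m + 1) * 16 ^ m := by ring
      _ ≤ 16 * (m + 1) * (4 * m * m.centralBinom ^ 2) := Nat.mul_le_mul_left _ ih
      _ = 16 * (4 * m * (m + 1)) * m.centralBinom ^ 2 := by ring
      _ ≤ 16 * (2 * m + 1) ^ 2 * m.centralBinom ^ 2 := by gcongr; nlinarith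
      _ = 4 * (2 * (2 * m + 1) * m.centralBinom) ^ 2 := by ring
      _ = 4 * ((m + 1) * (m + 1).centralBinom) ^ 2 := by rw [h]
      _ = _ := by ring

lemma two_mul_two_pow_lt_centralBinom {m : ℕ} (hm : 4 ≤ m) : 2 * 2 ^ m < m.centralBinom := by
  have h := Nat.four_pow_lt_mul_centralBinom m hm
  have h2 : 2 * m ≤ 2 ^ m := by
    induction m, hm using Nat.le_induction with
    | base => norm_num
    | succ k hk ih => have := ih (Nat.four_pow_lt_mul_centralBinom k hk); rw [pow_succ]; omega
  have h3 : 4 ^ m = 2 ^ m * 2 ^ m := by rw [← mul_pow]; norm_num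
  by_contra hc
  push Not at hc
  nlinarith [Nat.mul_le_mul_left m hc, Nat.mul_le_mul_right (2 ^ m) h2]

/-! ### Learners with a bounded number of requests -/

namespace Learner

variable {n : ℕ} (A : Learner n)

/-- The run of `A` on target `f` stops within `q` requests and returns a hypothesis within `ℓ₂`
distance `ε` of `f`. -/
def Succeeds (f : Cube n → ℝ) (q : ℕ) (ε : ℝ) (r : A.Seed × (ℕ → Cube n)) : Prop :=
  ∃ h, A.step r.1 (A.history f r.1 r.2 q) = .output h ∧ l2norm (f - h) ≤ ε

lemma history_add_of_output {f : Cube n → ℝ} {s : A.Seed} {X : ℕ → Cube n} {i : ℕ}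
    {h : Cube n → ℝ} (hi : A.step s (A.history f s X i) = .output h) (k : ℕ) :
    A.history f s X (i + k) = A.history f s X i := by
  induction k with
  | zero => rfl
  | succ k ih =>
    have : A.step s (A.history f s X (i + k)) = .output h := by rw [ih, hi]
    rw [← add_assoc, history, this]
    exact ih

/-- A stopped run is frozen, so success at an unspecified time can be tested at time `q`. -/
lemma step_history_eq_of_returns {f : Cube n → ℝ} {s : A.Seed} {X : ℕ → Cube n} {q : ℕ}
    {h : Cube n → ℝ} (hq : A.HaltsWithin f s X q) (hh : A.Returns f s X h) :
    A.step s (A.history f s X q) = .output h := by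
  obtain ⟨h', hq⟩ := hq
  obtain ⟨i, hi⟩ := hh
  rcases le_total i q with hiq | hiq
  · obtain ⟨k, rfl⟩ := Nat.exists_eq_add_of_le hiq
    rw [A.history_add_of_output hi, hi]
  · obtain ⟨k, rfl⟩ := Nat.exists_eq_add_of_le hiq
    rwa [A.history_add_of_output hq] at hi

/-! ### Measurability of the success event -/

/-- The unlabeled points received by `A` in its first `i` requests. -/
def points (f : Cube n → ℝ) (r : A.Seed × (ℕ → Cube n)) (i : ℕ) : List (Cube n) :=
  (A.history f r.1 r.2 i).map Prod.fst

/-- Labels are determined by `f`, so a history is encoded by a list of points. There are countably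
many such lists, which keeps the unions below countable. -/
lemma history_eq_map_points (f : Cube n → ℝ) (r : A.Seed × (ℕ → Cube n)) (i : ℕ) :
    A.history f r.1 r.2 i = (A.points f r i).map fun x => (x, f x) := by
  induction i with
  | zero => rfl
  | succ i ih =>
    unfold points at ih ⊢
    rw [history]
    split
    · rw [List.map_append, List.map_append, ← ih]; rfl
    · rw [List.map_append, List.map_append, ← ih]; rfl
    · exact ih

/-- The points received after one more request, if the next random example is at `x`. -/
def nextPoints (l : List (Cube n)) (x : Cube n) : Action n → List (Cube n)
  | .drawExample => l ++ [x]
  | .valueQuery y => l ++ [y]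
  | .output _ => l

lemma points_succ (f : Cube n → ℝ) (r : A.Seed × (ℕ → Cube n)) (i : ℕ) :
    A.points f r (i + 1) = nextPoints (A.points f r i) (r.2 i)
      (A.step r.1 ((A.points f r i).map fun x => (x, f x))) := by
  rw [← A.history_eq_map_points]
  unfold points
  rw [history]
  generalize A.step r.1 (A.history f r.1 r.2 i) = a
  cases a <;> simp [nextPoints]

lemma measurableSet_action {S : Set (Unit ⊕ Cube n ⊕ (Cube n → ℝ))} (hS : MeasurableSet S) :
    MeasurableSet (Action.toSum ⁻¹' S) := ⟨S, hS, rfl⟩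

lemma measurableSet_nextPoints_eq (l l' : List (Cube n)) (x : Cube n) :
    MeasurableSet {a : Action n | nextPoints l x a = l'} := by
  have : {a : Action n | nextPoints l x a = l'} = Action.toSum ⁻¹'
      {u | Sum.elim (fun _ => l ++ [x]) (Sum.elim (fun y => l ++ [y]) fun _ => l) u = l'} := by
    ext a
    cases a <;> rfl
  rw [this]
  refine measurableSet_action (measurableSet_sum_iff.2 ⟨MeasurableSet.of_discrete,
    measurableSet_sum_iff.2 ⟨MeasurableSet.of_discrete, ?_⟩⟩)
  exact MeasurableSet.const (l = l')

lemma measurableSet_output_close (f : Cube n → ℝ) (ε : ℝ) :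
    MeasurableSet {a : Action n | ∃ h, a = .output h ∧ l2norm (f - h) ≤ ε} := by
  have : {a : Action n | ∃ h, a = .output h ∧ l2norm (f - h) ≤ ε} = Action.toSum ⁻¹'
      (Sum.inr '' (Sum.inr '' {h | l2norm (f - h) ≤ ε})) := by
    ext a
    cases a <;> simp [Action.toSum]
  rw [this]
  refine measurableSet_action (MeasurableSet.inr_image (MeasurableSet.inr_image ?_))
  refine measurableSet_le ?_ measurable_const
  unfold l2norm
  simp only [Pi.sub_apply]
  fun_prop

lemma measurableSet_points_eq (f : Cube n → ℝ) (i : ℕ) (l : List (Cube n)) :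
    MeasurableSet {r | A.points f r i = l} := by
  induction i generalizing l with
  | zero => exact MeasurableSet.const ([] = l)
  | succ i ih =>
    have : {r | A.points f r (i + 1) = l} = ⋃ (l' : List (Cube n)) (x : Cube n),
        {r | A.points f r i = l'} ∩ ({r | r.2 i = x} ∩
          {r | nextPoints l' x (A.step r.1 (l'.map fun x => (x, f x))) = l}) := by
      ext r
      simp [points_succ]
    rw [this]
    refine MeasurableSet.iUnion fun l' => MeasurableSet.iUnion fun x =>
      (ih l').inter (MeasurableSet.inter ?_ ?_)
    · have hi : Measurable fun r : A.Seed × (ℕ → Cube n) => r.2 i := by fun_prop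
      exact hi (measurableSet_singleton x)
    · exact ((A.measurable_step _).comp measurable_fst) (measurableSet_nextPoints_eq l' l x)

lemma measurableSet_succeeds (f : Cube n → ℝ) (q : ℕ) (ε : ℝ) :
    MeasurableSet {r | A.Succeeds f q ε r} := by
  have : {r | A.Succeeds f q ε r} = ⋃ l : List (Cube n), {r | A.points f r q = l} ∩
      {r | ∃ h, A.step r.1 (l.map fun x => (x, f x)) = .output h ∧ l2norm (f - h) ≤ ε} := by
    ext r
    simp [Succeeds, history_eq_map_points]
  rw [this]
  exact MeasurableSet.iUnion fun l => (A.measurableSet_points_eq f q l).inter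
    (((A.measurable_step _).comp measurable_fst) (measurableSet_output_close f ε))

instance isProbabilityMeasure_runLaw : IsProbabilityMeasure A.runLaw := by
  unfold runLaw
  have : IsProbabilityMeasure (uniform n) := by unfold uniform; infer_instance
  infer_instance

lemma two_thirds_le_runLaw_succeeds {F : Set (Cube n → ℝ)} {ε : ℝ} {q : ℕ}
    (hA : A.PACLearns F ε) (hq : A.UsesAtMost F q) {f : Cube n → ℝ} (hf : f ∈ F) :
    2 / 3 ≤ A.runLaw {r | A.Succeeds f q ε r} := by
  refine (hA f hf).trans (measure_mono_ae ?_)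
  filter_upwards [hq f hf] with r hr
  rintro ⟨h, hret, hle⟩
  exact ⟨h, A.step_history_eq_of_returns hr hret, hle⟩

/-! ### Counting runs -/

-- With seed and examples fixed, the only branching is between the labels `u x` and `v x` of the
-- requested point.
open Classical in
lemma card_image_history_le {ι : Type*} (B : Finset ι) (G : ι → Cube n → ℝ) (u v : Cube n → ℝ)
    (hG : ∀ b ∈ B, ∀ x, G b x = u x ∨ G b x = v x) (s : A.Seed) (X : ℕ → Cube n) (i : ℕ) :
    (B.image fun b => A.history (G b) s X i).card ≤ 2 ^ i := by
  induction i with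
  | zero =>
    refine (card_le_card ((image_subset_iff (t := {[]})).2 fun b _ => ?_)).trans (by simp)
    simp [history]
  | succ i ih =>
    let next : List (Cube n × ℝ) → Finset (List (Cube n × ℝ)) := fun l =>
      match A.step s l with
      | .drawExample => {l ++ [(X i, u (X i))], l ++ [(X i, v (X i))]}
      | .valueQuery x => {l ++ [(x, u x)], l ++ [(x, v x)]}
      | .output _ => {l}
    have hnext : ∀ l, (next l).card ≤ 2 := fun l => by
      simp only [next]
      split
      · exact card_le_two
      · exact card_le_two
      · simp
    have hsub : (B.image fun b => A.history (G b) s X (i + 1)) ⊆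
        (B.image fun b => A.history (G b) s X i).biUnion next := by
      refine image_subset_iff.2 fun b hb => mem_biUnion.2 ⟨_, mem_image_of_mem _ hb, ?_⟩
      rcases hstep : A.step s (A.history (G b) s X i) with _ | x | h
      · rcases hG b hb (X i) with h | h <;> simp [next, history, hstep, h]
      · rcases hG b hb x with h | h <;> simp [next, history, hstep, h]
      · simp [next, history, hstep]
    calc _ ≤ _ := card_le_card hsub
      _ ≤ (B.image fun b => A.history (G b) s X i).card * 2 :=
          card_biUnion_le_card_mul _ _ _ fun l _ => hnext l
      _ ≤ 2 ^ (i + 1) := by rw [pow_succ]; exact Nat.mul_le_mul_right _ ih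

-- Targets sharing a history receive the same hypothesis, so those on which the run succeeds lie in
-- one `ε`-ball.
open Classical in
lemma card_succeeds_le {ι : Type*} (B : Finset ι) (G : ι → Cube n → ℝ) (u v : Cube n → ℝ)
    (hG : ∀ b ∈ B, ∀ x, G b x = u x ∨ G b x = v x) {ε : ℝ} {K : ℕ}
    (hK : ∀ h, (B.filter fun b => l2norm (G b - h) ≤ ε).card ≤ K) (q : ℕ)
    (r : A.Seed × (ℕ → Cube n)) :
    (B.filter fun b => A.Succeeds (G b) q ε r).card ≤ K * 2 ^ q := by
  refine (card_le_mul_card_image (f := fun b => A.history (G b) r.1 r.2 q) _ K ?_).trans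
    (Nat.mul_le_mul_left _ ((card_le_card (image_subset_image (filter_subset _ _))).trans
      (A.card_image_history_le B G u v hG r.1 r.2 q)))
  intro l hl
  obtain ⟨b₀, hb₀, rfl⟩ := mem_image.1 hl
  obtain ⟨-, h, hstep, -⟩ := mem_filter.1 hb₀
  refine (card_le_card fun b hb => ?_).trans (hK h)
  simp only [mem_filter] at hb ⊢
  obtain ⟨⟨hbB, h', hstep', hle⟩, heq⟩ := hb
  rw [heq, hstep] at hstep'
  cases hstep'
  exact ⟨hbB, hle⟩

open Classical in
/-- If every `ℓ₂` ball of radius `ε` contains at most `K` targets of a family of targets with two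
possible values at each point, then a learner with `q` requests can learn at most
`(3 / 2) * K * 2 ^ q` targets. -/
theorem two_mul_card_le {F : Set (Cube n → ℝ)} {ε : ℝ} {q : ℕ} (hA : A.PACLearns F ε)
    (hq : A.UsesAtMost F q) {ι : Type*} (B : Finset ι) (G : ι → Cube n → ℝ)
    (hF : ∀ b ∈ B, G b ∈ F) (u v : Cube n → ℝ)
    (hG : ∀ b ∈ B, ∀ x, G b x = u x ∨ G b x = v x) {K : ℕ}
    (hK : ∀ h, (B.filter fun b => l2norm (G b - h) ≤ ε).card ≤ K) :
    2 * B.card ≤ 3 * (K * 2 ^ q) := by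
  have h1 : (B.card : ENNReal) * (2 / 3) ≤ (K * 2 ^ q : ℕ) := by
    -- The expected number of targets learned by a run is bounded below by the success probabilities
    -- and above pointwise.
    calc (B.card : ENNReal) * (2 / 3) = ∑ b ∈ B, (2 / 3 : ENNReal) := by simp
      _ ≤ ∑ b ∈ B, A.runLaw {r | A.Succeeds (G b) q ε r} :=
          sum_le_sum fun b hb => A.two_thirds_le_runLaw_succeeds hA hq (hF b hb)
      _ = ∑ b ∈ B, ∫⁻ r, {r | A.Succeeds (G b) q ε r}.indicator 1 r ∂A.runLaw :=
          sum_congr rfl fun b _ => (lintegral_indicator_one (A.measurableSet_succeeds _ _ _)).symm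
      _ = ∫⁻ r, ∑ b ∈ B, {r | A.Succeeds (G b) q ε r}.indicator 1 r ∂A.runLaw :=
          (lintegral_finsetSum _ fun b _ =>
            measurable_one.indicator (A.measurableSet_succeeds _ _ _)).symm
      _ = ∫⁻ r, ((B.filter fun b => A.Succeeds (G b) q ε r).card : ENNReal) ∂A.runLaw := by
          refine lintegral_congr fun r => ?_
          simp [Set.indicator_apply]
      _ ≤ ∫⁻ _, ((K * 2 ^ q : ℕ) : ENNReal) ∂A.runLaw :=
          lintegral_mono fun r => Nat.cast_le.2 (A.card_succeeds_le B G u v hG hK q r)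
      _ = _ := by simp
  have h2 := ENNReal.toReal_mono (ENNReal.natCast_ne_top _) h1
  simp only [ENNReal.toReal_mul, ENNReal.toReal_natCast, ENNReal.toReal_div,
    ENNReal.toReal_ofNat] at h2
  have h3 : (2 * B.card : ℝ) ≤ 3 * (K * 2 ^ q : ℕ) := by linarith
  exact_mod_cast h3

end Learner

/-! ### The lower bound -/

/-- The exponent 5 is 4 from the squared `m²` plus 1 from the squared `√m` of the central binomial
estimate. -/
lemma sixteen_mul_card_symmDiff_le {n m : ℕ} (hm : 0 < m) {ε : ℝ}
    (hε : (m : ℝ) ^ 5 * ε ^ 4 * 2 ^ 18 ≤ 1) {T : Finset (Fin n)} (hT : T.card = 2 * m)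
    {b b' : Finset (Finset (Fin n))} (hb : b ⊆ T.powersetCard m) (hb' : b' ⊆ T.powersetCard m)
    {h : Cube n → ℝ} (hbh : l2norm (target T m b - h) ≤ ε)
    (hbh' : l2norm (target T m b' - h) ≤ ε) :
    16 * (b ∆ b').card ≤ m.centralBinom := by
  have hn : 2 * m ≤ n := by simpa [hT] using card_le_univ T
  have h1 := card_symmDiff_mul_le_sum T hm hb hb'
  have h2 := sum_sq_sub_le hbh hbh'
  have hpow : (2 : ℝ) ^ n = 4 ^ m * 2 ^ (n - 2 * m) := by
    rw [show (4 : ℝ) = 2 ^ 2 by norm_num, ← pow_mul, ← pow_add, Nat.add_sub_cancel' hn]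
  have h3 : ((b ∆ b').card : ℝ) ≤ 16 * m ^ 2 * ε ^ 2 * 4 ^ m := by
    rw [hT] at h1
    rw [hpow] at h2
    refine le_of_mul_le_mul_right (a := (2 : ℝ) ^ (n - 2 * m)) ?_ (by positivity)
    calc _ ≤ _ := h1
      _ ≤ 4 * (m : ℝ) ^ 2 * (4 * ε ^ 2 * (4 ^ m * 2 ^ (n - 2 * m))) := by gcongr
      _ = _ := by ring
  have h4 : (16 : ℝ) ^ m ≤ 4 * m * m.centralBinom ^ 2 := by
    exact_mod_cast sixteen_pow_le_mul_centralBinom_sq hm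
  have h5 : (16 * ((b ∆ b').card : ℝ)) ^ 2 ≤ (m.centralBinom : ℝ) ^ 2 := by
    calc (16 * ((b ∆ b').card : ℝ)) ^ 2 ≤ (16 * (16 * m ^ 2 * ε ^ 2 * 4 ^ m)) ^ 2 := by gcongr
      _ = 2 ^ 16 * m ^ 4 * ε ^ 4 * 16 ^ m := by
        rw [show (16 : ℝ) ^ m = (4 ^ m) ^ 2 by rw [← pow_mul, mul_comm, pow_mul]; norm_num]
        ring
      _ ≤ 2 ^ 16 * m ^ 4 * ε ^ 4 * (4 * m * m.centralBinom ^ 2) := by gcongr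
      _ = (m : ℝ) ^ 5 * ε ^ 4 * 2 ^ 18 * m.centralBinom ^ 2 := by ring
      _ ≤ 1 * m.centralBinom ^ 2 := by gcongr
      _ = _ := one_mul _
  have h6 := le_of_sq_le_sq h5 (by positivity)
  exact_mod_cast h6

theorem Learner.two_pow_le_of_pacLearns {n m : ℕ} (hm : 4 ≤ m) (hn : 2 * m ≤ n) {ε : ℝ}
    (hε : (m : ℝ) ^ 5 * ε ^ 4 * 2 ^ 18 ≤ 1) (A : Learner n)
    (hA : A.PACLearns (monotoneSubmodular n) ε) {q : ℕ}
    (hq : A.UsesAtMost (monotoneSubmodular n) q) : 2 ^ m ≤ q := by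
  classical
  have hm0 : 0 < m := by omega
  obtain ⟨T, -, hT⟩ := exists_subset_card_eq (s := (univ : Finset (Fin n))) (n := 2 * m)
    (by simpa using hn)
  set P := T.powersetCard m
  have hP : P.card = m.centralBinom := by
    rw [card_powersetCard, hT, Nat.centralBinom]
  set K := Nat.sqrt (2 ^ P.card)
  have hK : ∀ h, (P.powerset.filter fun b => l2norm (target T m b - h) ≤ ε).card ≤ K := by
    intro h
    -- The hypothesis `h` is arbitrary, so the ball is recentred at one of its own targets.
    rcases (P.powerset.filter fun b => l2norm (target T m b - h) ≤ ε).eq_empty_or_nonempty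
      with he | ⟨b₀, hb₀⟩
    · simp [he]
    obtain ⟨hb₀, hb₀h⟩ := mem_filter.1 hb₀
    refine Nat.le_sqrt'.2 (card_hammingBall_sq_le P b₀ (mem_powerset.1 hb₀) _ fun b hb => ?_)
    obtain ⟨hb, hbh⟩ := mem_filter.1 hb
    rw [mem_powerset] at hb hb₀
    exact ⟨hb, hP ▸ sixteen_mul_card_symmDiff_le hm0 hε hT hb hb₀ hbh hb₀h⟩
  have hmain := A.two_mul_card_le hA hq P.powerset (target T m)
    (fun b _ => target_mem_monotoneSubmodular T hm0 b) _ _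
    (fun b _ x => target_eq_or T m b x) hK
  rw [card_powerset] at hmain
  have hK2 : K ^ 2 ≤ 2 ^ P.card := Nat.sqrt_le' _
  have h1 : 2 ^ P.card * 2 ^ P.card * 4 ≤ 9 * 2 ^ (2 * q) * 2 ^ P.card := by
    calc 2 ^ P.card * 2 ^ P.card * 4 = (2 * 2 ^ P.card) ^ 2 := by ring
      _ ≤ (3 * (K * 2 ^ q)) ^ 2 := Nat.pow_le_pow_left hmain 2
      _ = 9 * 2 ^ (2 * q) * K ^ 2 := by ring
      _ ≤ _ := Nat.mul_le_mul_left _ hK2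
  have h2 : 2 ^ P.card * 4 ≤ 9 * 2 ^ (2 * q) :=
    Nat.le_of_mul_le_mul_right (c := 2 ^ P.card) (by linarith) (by positivity)
  -- Here `9 < 16` gives `P.card ≤ 2q + 1`, and `P.card ≥ 2 * 2 ^ m + 1` then yields `2 ^ m ≤ q`
  -- without loss.
  have h3 : 2 ^ P.card < 2 ^ (2 * q + 2) := by
    have : 0 < 2 ^ (2 * q) := by positivity
    rw [pow_add]
    omega
  have h4 := (Nat.pow_lt_pow_iff_right (by norm_num)).1 h3
  have h5 := two_mul_two_pow_lt_centralBinom hm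
  omega

end SubmodularLearning

end

theorem mainTheorem9 :
    ∃ c C ε₀ : ℝ, 0 < c ∧ 0 < C ∧ 0 < ε₀ ∧
      ∀ ε : ℝ, 0 < ε → ε ≤ ε₀ →
        ∀ n : ℕ, C * ε ^ (-(4 / 5) : ℝ) ≤ (n : ℝ) →
          ∀ A : SubmodularLearning.Learner n,
            A.PACLearns (SubmodularLearning.monotoneSubmodular n) ε →
              ∀ q : ℕ, A.UsesAtMost (SubmodularLearning.monotoneSubmodular n) q →
                (2 : ℝ) ^ (c * ε ^ (-(4 / 5) : ℝ)) ≤ (q : ℝ) := by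
  refine ⟨1 / 32, 1 / 8, 1 / 1024, by norm_num, by norm_num, by norm_num, ?_⟩
  intro ε hε hε₀ n hn A hA q hq
  set E := ε ^ (-(4 / 5) : ℝ)
  have hE : 0 < E := Real.rpow_pos_of_pos hε _
  have hE5 : E ^ 5 * ε ^ 4 = 1 := by
    rw [← Real.rpow_natCast E 5, ← Real.rpow_natCast ε 4, ← Real.rpow_mul hε.le,
      ← Real.rpow_add hε]
    norm_num
  -- The bound `1/1024` is the exact threshold: `256 ^ 5 = 1024 ^ 4`.
  have hE256 : 256 ≤ E := by
    by_contra hlt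
    have h1 : E ^ 5 * ε ^ 4 < 256 ^ 5 * (1 / 1024) ^ 4 :=
      mul_lt_mul (pow_lt_pow_left₀ (not_le.1 hlt) hE.le (by norm_num))
        (pow_le_pow_left₀ hε.le hε₀ 4) (by positivity) (by positivity)
    rw [hE5] at h1
    norm_num at h1
  -- The divisor 16 turns `2 ^ 18` into `2 ^ 18 / 16 ^ 5 = 1/4`; rounding down still leaves `m ≥ E /
  -- 32`.
  set m := ⌊E / 16⌋₊
  have hm1 : (m : ℝ) ≤ E / 16 := Nat.floor_le (by positivity)
  have hm2 : E / 16 < m + 1 := Nat.lt_floor_add_one _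
  have hm : 4 ≤ m := Nat.le_floor (by push_cast; linarith)
  have hmn : 2 * m ≤ n := by
    have : (2 * m : ℝ) ≤ n := by linarith
    exact_mod_cast this
  have hmε : (m : ℝ) ^ 5 * ε ^ 4 * 2 ^ 18 ≤ 1 := by
    calc (m : ℝ) ^ 5 * ε ^ 4 * 2 ^ 18 ≤ (E / 16) ^ 5 * ε ^ 4 * 2 ^ 18 := by gcongr
      _ = E ^ 5 * ε ^ 4 * (1 / 4) := by ring
      _ ≤ 1 := by rw [hE5]; norm_num
  have hfin : (2 : ℝ) ^ m ≤ q := by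
    exact_mod_cast A.two_pow_le_of_pacLearns hm hmn hmε hA hq
  refine le_trans ?_ hfin
  rw [← Real.rpow_natCast]
  exact Real.rpow_le_rpow_of_exponent_le (by norm_num) (by linarith)
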